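/- Let $k \ge 1$, let $\Sigma=\{1,\dots,k\}$ and let $\sigma:\Sigma^{\mathbb N}\to\Sigma^{\mathbb N}$ be the left-sided full shift, $\sigma(i_1i_2i_3\cdots)=(i_2i_3\cdots)$. Endow $\Sigma^{\mathbb N}$ with the metric $d(x,y)=2^{-N}$ for $x\neq y$, where $N$ is the length of the longest common initial word of $x$ and $y$. Put $d_n(x,y)=\max_{0\le j<n}d(\sigma^jx,\sigma^jy)$, and write $C_n(x)$ for the set of all sequences that share the first $n$ symbols with $x$. Let $\mathcal F=(f_n)_{n\ge1}$ be a sequence of functions $f_n:\Sigma^{\mathbb N}\to\mathbb R$. - $\mathcal F$ is *almost additive* if there is $C>0$ such that $-C+f_m(x)+f_n(\sigma^mx)\le f_{m+n}(x)\le f_m(x)+f_n(\sigma^mx)+C$ for all $x$ and all $m,n\ge1$. - $\mathcal F$ has *bounded variation* if there are $\varepsilon>0$ and $M>0$ such that, for all $n\ge1$ and all $x,y$, $d_n(x,y)<\varepsilon$ implies $|f_n(x)-f_n(y)|\le M$. - The *topological pressure* of $\mathcal F$ is $$P_\sigma(\mathcal F)=\lim_{\varepsilon\to0}\limsup_{n\to\infty}\frac1n\log\sup_E\sum_{x\in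 E}e^{f_n(x)},$$ where $E$ runs over the finite $(n,\varepsilon)$-separated sets, that is, those with $d_n(x,y)>\varepsilon$ for all distinct $x,y\in E$. - A Borel probability measure $\mu$ on $\Sigma^{\mathbb N}$ (not necessarily invariant) is a *Gibbs measure* for $\mathcal F$ if $P_\sigma(\mathcal F)$ is finite and there is $K\ge1$ such that $$K^{-1}\le\frac{\mu(C_n(x))}{\exp(-nP_\sigma(\mathcal F)+f_n(x))}\le K\qquad\text{for all }x\in\Sigma^{\mathbb N}\text{ and all }n\ge1.$$ For a function $\varphi:\Sigma^{\mathbb N}\to\mathbb R$ let $S_n\varphi=\sum_{j=0}^{n-1}\varphi\circ\sigma^j$. The function $\varphi$ is *Bowen* if $(S_n\varphi)_{n\ge1}$ has bounded variation, and a *Gibbs measure for* $\varphi$ is a Gibbs measure for $(S_n\varphi)_{n\ge1}$. Then: 1. A continuous function $\varphi:\Sigma^{\mathbb N}\to\mathbb R$ is Bowen if and only if there exists a Gibbs measure for $\varphi$. 2. An almost additive sequence $\mathcal F=(f_n)_{n\ge1}$ of continuous functions $f_n:\Sigma^{\mathbb N}\to\mathbb R$ has bounded variation if and only if there exists a Gibbs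 measure for $\mathcal F$. -/

import Mathlib

open Filter MeasureTheory
open scoped ENNReal

noncomputable section

namespace NonaddThermo

section General

variable {X : Type*} [MetricSpace X]

/-- The sequence `(f n)`, `n ≥ 1`, is almost additive with respect to `T`: there is `C > 0` with
`-C + f m x + f n (T^m x) ≤ f (m + n) x ≤ f m x + f n (T^m x) + C` for all `x` and `m, n ≥ 1`.
(Sequences are indexed by `ℕ`, but the term of index `0` is never used.) -/
def AlmostAdditive (T : X → X) (f : ℕ → X → ℝ) : Prop :=
  ∃ C : ℝ, 0 < C ∧ ∀ (x : X) (m n : ℕ), 1 ≤ m → 1 ≤ n →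
    -C + f m x + f n (T^[m] x) ≤ f (m + n) x ∧ f (m + n) x ≤ f m x + f n (T^[m] x) + C

/-- The sequence `(f n)`, `n ≥ 1`, has bounded variation with respect to `T`: there are `ε > 0` and
`M > 0` such that `|f n x - f n y| ≤ M` whenever `d(T^j x, T^j y) < ε` for all `0 ≤ j ≤ n - 1`. -/
def HasBoundedVariation (T : X → X) (f : ℕ → X → ℝ) : Prop :=
  ∃ M : ℝ, 0 < M ∧ ∃ ε : ℝ, 0 < ε ∧ ∀ (x y : X) (n : ℕ), 1 ≤ n →
    (∀ j < n, dist (T^[j] x) (T^[j] y) < ε) → |f n x - f n y| ≤ M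

/-- The Bowen property of a function: its Birkhoff sums
`S_n φ = ∑_{j < n} φ ∘ T^j` form a sequence of bounded variation. -/
def IsBowen (T : X → X) (φ : X → ℝ) : Prop :=
  HasBoundedVariation T (birkhoffSum T φ)

/-- `E` is `(n, ε)`-separated: distinct points `x, y` of `E` satisfy
`max_{0 ≤ j < n} d(T^j x, T^j y) > ε`. -/
def IsDynSeparated (T : X → X) (n : ℕ) (ε : ℝ) (E : Finset X) : Prop :=
  ∀ x ∈ E, ∀ y ∈ E, x ≠ y → ∃ j < n, ε < dist (T^[j] x) (T^[j] y)

/-- `sup_E ∑_{x ∈ E} exp (f n x)` over all finite `(n, ε)`-separated sets `E`. -/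
def separatedSum (T : X → X) (f : ℕ → X → ℝ) (n : ℕ) (ε : ℝ) : ℝ≥0∞ :=
  ⨆ (E : Finset X) (_ : IsDynSeparated T n ε E), ∑ x ∈ E, ENNReal.ofReal (Real.exp (f n x))

/-- The topological pressure of a sequence of potentials,
`lim_{ε → 0} limsup_{n → ∞} (1/n) log sup_E ∑_{x ∈ E} exp (f n x)`,
as an extended real number; the limit as `ε → 0` is a supremum because the inner quantity increases
as `ε` decreases. -/
def pressure (T : X → X) (f : ℕ → X → ℝ) : EReal :=
  ⨆ (ε : ℝ) (_ : 0 < ε),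
    limsup (fun n : ℕ => ENNReal.log (separatedSum T f n ε) / (n : EReal)) atTop

end General

/-- The space of one-sided sequences over an alphabet with `k` symbols. -/
abbrev SeqSpace (k : ℕ) : Type := ℕ → Fin k

/-- The usual metric on sequences: `d(x, y) = (1/2)^N` with `N` the first index where the sequences
`x ≠ y` differ. It induces the product topology of the discrete topologies. -/
instance (k : ℕ) : MetricSpace (SeqSpace k) := PiNat.metricSpace

/-- The left shift. -/
def shift {k : ℕ} (x : SeqSpace k) : SeqSpace k := fun i => x (i + 1)

/-- The probability measure `μ` on the full shift (not assumed invariant) is a Gibbs measure for the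
sequence `(f n)`, `n ≥ 1`: the pressure `P` of the sequence is finite and there is `K ≥ 1` with
`K⁻¹ ≤ μ(C) / exp (-n P + f n x) ≤ K` for all `x` and `n ≥ 1`, where `C` is the cylinder of the
sequences that share the first `n` symbols with `x`. -/
def IsGibbs {k : ℕ} (f : ℕ → SeqSpace k → ℝ) (μ : Measure (SeqSpace k)) : Prop :=
  IsProbabilityMeasure μ ∧ ∃ P : ℝ, pressure shift f = (P : EReal) ∧
    ∃ K : ℝ, 1 ≤ K ∧ ∀ (x : SeqSpace k) (n : ℕ), 1 ≤ n →
      K⁻¹ ≤ μ.real (PiNat.cylinder x n) / Real.exp (-(n * P) + f n x) ∧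
        μ.real (PiNat.cylinder x n) / Real.exp (-(n * P) + f n x) ≤ K

/-- A Gibbs measure for a single function `φ` is a Gibbs measure for its Birkhoff sums. -/
def IsGibbsFor {k : ℕ} (φ : SeqSpace k → ℝ) (μ : Measure (SeqSpace k)) : Prop :=
  IsGibbs (birkhoffSum shift φ) μ

end NonaddThermo

end

open Filter MeasureTheory
open scoped ENNReal Topology

namespace NonaddThermo

/-! Birkhoff sums are almost additive, so the statement on functions is a case of the one on
sequences. If `μ` is Gibbs, points of one `n`-cylinder share its mass, so their `f n` values differ
by at most `2 log K`. Conversely, let `Z n` be the sum of `exp (f n)` over words of length `n`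
(`wordSum`). Almost additivity and bounded variation make `Z (m + l)` comparable to `Z m * Z l`, so
`log (Z n) = n P + O(1)`, and `P` is the pressure. The atomic measures with weights `exp (f n) / Z
n` give an `m`-cylinder mass comparable to `exp (f m) * Z (n - m) / Z n`, hence to `exp (f m - m
P)`, uniformly in `n > m`. Cylinders are clopen, so the bounds pass to a weak limit, which is Gibbs.
-/

/-- A sequence that is additive up to a bounded error is linear up to the same error. -/
theorem exists_abs_sub_mul_le_of_almost_additive {u : ℕ → ℝ} {D : ℝ}
    (h : ∀ m n, 1 ≤ m → 1 ≤ n → |u (m + n) - (u m + u n)| ≤ D) :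
    ∃ P : ℝ, ∀ n : ℕ, 1 ≤ n → |u n - n * P| ≤ D := by
  have up : ∀ n : ℕ, 1 ≤ n → ∀ j : ℕ, 1 ≤ j → u (j * n) + D ≤ j * (u n + D) := by
    intro n hn j hj
    induction j, hj using Nat.le_induction with
    | base => simp
    | succ j hj ih =>
      have := abs_le.1 (h (j * n) n (Nat.mul_pos hj hn) hn)
      rw [Nat.succ_mul]
      push_cast
      linarith [this.2]
  have lo : ∀ n : ℕ, 1 ≤ n → ∀ j : ℕ, 1 ≤ j → j * (u n - D) ≤ u (j * n) - D := by
    intro n hn j hj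
    induction j, hj using Nat.le_induction with
    | base => simp
    | succ j hj ih =>
      have := abs_le.1 (h (j * n) n (Nat.mul_pos hj hn) hn)
      rw [Nat.succ_mul]
      push_cast
      linarith [this.1]
  have hD : 0 ≤ D := (abs_nonneg _).trans (h 1 1 le_rfl le_rfl)
  -- Each `(u n - D) / n` lies below each `(u m + D) / m`, as comparison with `u (n * m)` shows; `P`
  -- separates the two families.
  obtain ⟨P, hP1, hP2⟩ := exists_between_of_forall_le
    (s := (fun n : ℕ => (u n - D) / n) '' Set.Ici 1) (t := (fun n : ℕ => (u n + D) / n) '' Set.Ici 1)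
    ⟨_, 1, Set.self_mem_Ici, rfl⟩ ⟨_, 1, Set.self_mem_Ici, rfl⟩ (by
      rintro _ ⟨n, hn, rfl⟩ _ ⟨m, hm, rfl⟩
      have hn' : (0 : ℝ) < n := Nat.cast_pos.2 hn
      have hm' : (0 : ℝ) < m := Nat.cast_pos.2 hm
      have h1 := up m hm n hn
      have h2 := lo n hn m hm
      rw [mul_comm m n] at h2
      simp only
      rw [div_le_div_iff₀ hn' hm']
      linarith)
  refine ⟨P, fun n hn => ?_⟩
  have hn' : (0 : ℝ) < n := Nat.cast_pos.2 hn
  have h1 := (div_le_iff₀ hn').1 (hP1 ⟨n, hn, rfl⟩)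
  have h2 := (le_div_iff₀ hn').1 (hP2 ⟨n, hn, rfl⟩)
  rw [abs_le]
  constructor <;> linarith

/-! ### Cylinders, the metric and finite words -/

section Shift

variable {k : ℕ}

theorem shift_iterate_apply (j : ℕ) (x : SeqSpace k) (i : ℕ) : shift^[j] x i = x (i + j) := by
  induction j generalizing x with
  | zero => rfl
  | succ j ih =>
    rw [Function.iterate_succ_apply, ih]
    rfl

theorem continuous_shift : Continuous (shift : SeqSpace k → SeqSpace k) :=
  continuous_pi fun i => continuous_apply (i + 1)

theorem shift_iterate_mem_cylinder {x y : SeqSpace k} {j n : ℕ}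
    (h : y ∈ PiNat.cylinder x (j + n)) : shift^[j] y ∈ PiNat.cylinder (shift^[j] x) n := by
  intro i hi
  rw [shift_iterate_apply, shift_iterate_apply]
  exact h _ (by omega)

theorem dist_shift_iterate_le {x y : SeqSpace k} {j n q : ℕ} (hj : j < n)
    (h : y ∈ PiNat.cylinder x (n + q)) :
    dist (shift^[j] x) (shift^[j] y) ≤ (1 / 2 : ℝ) ^ q := by
  rw [dist_comm]
  exact PiNat.mem_cylinder_iff_dist_le.1 <| shift_iterate_mem_cylinder <|
    PiNat.cylinder_anti x (by omega) h

theorem dist_eq_one_of_apply_zero_ne {x y : SeqSpace k} (h : x 0 ≠ y 0) : dist x y = 1 := by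
  have hne : x ≠ y := fun e => h (e ▸ rfl)
  have h0 : PiNat.firstDiff x y = 0 := by
    by_contra h0
    exact h (PiNat.apply_eq_of_lt_firstDiff (Nat.pos_of_ne_zero h0))
  exact (PiNat.dist_eq_of_ne hne).trans (by rw [h0, pow_zero])

theorem mem_cylinder_of_dist_shift_iterate_lt_one {x y : SeqSpace k} {n : ℕ}
    (h : ∀ j < n, dist (shift^[j] x) (shift^[j] y) < 1) : y ∈ PiNat.cylinder x n := by
  intro j hj
  by_contra hne
  refine (h j hj).ne (dist_eq_one_of_apply_zero_ne ?_)
  simpa [shift_iterate_apply] using Ne.symm hne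

/-- The first `n` symbols of a sequence. -/
def initialWord (n : ℕ) (x : SeqSpace k) : Fin n → Fin k := fun i => x i

/-- A finite word continued by zeros. -/
def extendZero [NeZero k] {n : ℕ} (w : Fin n → Fin k) : SeqSpace k :=
  fun i => if h : i < n then w ⟨i, h⟩ else 0

variable [NeZero k]

theorem initialWord_extendZero {n : ℕ} (w : Fin n → Fin k) : initialWord n (extendZero w) = w := by
  funext i
  simp [initialWord, extendZero]

theorem extendZero_mem_cylinder_iff {n : ℕ} (w : Fin n → Fin k) (x : SeqSpace k) :
    extendZero w ∈ PiNat.cylinder x n ↔ w = initialWord n x := by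
  constructor
  · intro h
    funext i
    simpa [extendZero, initialWord] using h i i.2
  · rintro rfl i hi
    simp [extendZero, hi, initialWord]

theorem extendZero_append_mem_cylinder_iff {m l : ℕ} (u : Fin m → Fin k) (v : Fin l → Fin k)
    (x : SeqSpace k) :
    extendZero (Fin.append u v) ∈ PiNat.cylinder x m ↔ u = initialWord m x := by
  have hu : ∀ i (hi : i < m), extendZero (Fin.append u v) i = u ⟨i, hi⟩ := by
    intro i hi
    rw [extendZero, dif_pos (by omega)]
    exact Fin.append_left u v ⟨i, hi⟩
  constructor
  · intro h
    funext i
    exact (hu i i.2).symm.trans (h i i.2)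
  · rintro rfl i hi
    exact hu i hi

theorem shift_iterate_extendZero_append {m l : ℕ} (u : Fin m → Fin k) (v : Fin l → Fin k) :
    shift^[m] (extendZero (Fin.append u v)) = extendZero v := by
  funext i
  rw [shift_iterate_apply]
  by_cases hi : i < l
  · rw [extendZero, extendZero, dif_pos (by omega), dif_pos hi]
    convert Fin.append_right u v ⟨i, hi⟩ using 2
    ext
    simp [add_comm]
  · rw [extendZero, extendZero, dif_neg (by omega), dif_neg hi]

end Shift

/-! ### Bounded variation on cylinders -/

section Cylinder

variable {k : ℕ}

/-- Bounded variation of the terms `f n`, `n ≥ 1`, on cylinders of length `n`. -/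
def HasCylinderVariation (f : ℕ → SeqSpace k → ℝ) (M : ℝ) : Prop :=
  ∀ (n : ℕ) (x y : SeqSpace k), 1 ≤ n → y ∈ PiNat.cylinder x n → |f n x - f n y| ≤ M

/-- The almost additivity condition with a given constant. -/
def AlmostAdditiveWith (f : ℕ → SeqSpace k → ℝ) (C : ℝ) : Prop :=
  ∀ (x : SeqSpace k) (m n : ℕ), 1 ≤ m → 1 ≤ n →
    |f (m + n) x - (f m x + f n (shift^[m] x))| ≤ C

theorem AlmostAdditive.exists_with {f : ℕ → SeqSpace k → ℝ} (h : AlmostAdditive shift f) :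
    ∃ C, AlmostAdditiveWith f C := by
  obtain ⟨C, -, hC⟩ := h
  refine ⟨C, fun x m n hm hn => ?_⟩
  have := hC x m n hm hn
  rw [abs_le]
  constructor <;> linarith [this.1, this.2]

theorem exists_forall_abs_le_of_continuous {g : SeqSpace k → ℝ} (hg : Continuous g) :
    ∃ B, ∀ x, |g x| ≤ B := by
  obtain ⟨B, hB⟩ := isCompact_univ.exists_bound_of_continuousOn hg.continuousOn
  exact ⟨B, fun x => hB x trivial⟩

/-- Points of an `n`-cylinder stay `ε`-close only until a fixed number of steps before time `n`.
Almost additivity splits off this tail, on which `f` is bounded by compactness; small `n` are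
bounded outright. -/
theorem HasBoundedVariation.exists_hasCylinderVariation {f : ℕ → SeqSpace k → ℝ} {C : ℝ}
    (hf : ∀ n, 1 ≤ n → Continuous (f n)) (hA : AlmostAdditiveWith f C)
    (h : HasBoundedVariation shift f) : ∃ M, HasCylinderVariation f M := by
  obtain ⟨M, hM, ε, hε, h⟩ := h
  have hB : ∀ n, ∃ B, 1 ≤ n → ∀ x, |f n x| ≤ B := by
    intro n
    by_cases hn : 1 ≤ n
    · obtain ⟨B, hB⟩ := exists_forall_abs_le_of_continuous (hf n hn)
      exact ⟨B, fun _ => hB⟩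
    · exact ⟨0, fun h => absurd h hn⟩
  choose B hB using hB
  obtain ⟨q, hq⟩ := exists_pow_lt_of_lt_one hε (by norm_num : (1 / 2 : ℝ) < 1)
  -- Passing to `q + 1` keeps the tail length positive, as almost additivity and continuity require.
  have hq1 : (1 / 2 : ℝ) ^ (q + 1) < ε :=
    (pow_le_pow_of_le_one (by norm_num) (by norm_num) q.le_succ).trans_lt hq
  set S := ∑ i ∈ Finset.range (q + 2), |B i| with hS
  have hBS : ∀ n, n ≤ q + 1 → B n ≤ S := fun n hn =>
    (le_abs_self _).trans <| Finset.single_le_sum (f := fun i => |B i|)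
      (fun i _ => abs_nonneg _) (Finset.mem_range.2 (by omega))
  refine ⟨M + 2 * |C| + 2 * S, fun n x y hn hxy => ?_⟩
  have hC := le_abs_self C
  have hC' := abs_nonneg C
  by_cases hnq : n ≤ q + 1
  · have hx := abs_le.1 (hB n hn x)
    have hy := abs_le.1 (hB n hn y)
    have := hBS n hnq
    rw [abs_le]
    constructor <;> linarith [hx.1, hx.2, hy.1, hy.2]
  · obtain ⟨p, rfl⟩ : ∃ p, n = p + (q + 1) := ⟨n - (q + 1), by omega⟩
    have hp : 1 ≤ p := by omega
    have h1 := abs_le.1 <|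
      h x y p hp fun j hj => (dist_shift_iterate_le hj hxy).trans_lt hq1
    have hx := abs_le.1 (hA x p (q + 1) hp (by omega))
    have hy := abs_le.1 (hA y p (q + 1) hp (by omega))
    have hx' := abs_le.1 (hB (q + 1) (by omega) (shift^[p] x))
    have hy' := abs_le.1 (hB (q + 1) (by omega) (shift^[p] y))
    have := hBS (q + 1) le_rfl
    rw [abs_le]
    constructor <;> linarith [hx.1, hx.2, hy.1, hy.2, h1.1, h1.2, hx'.1, hx'.2, hy'.1, hy'.2]

theorem IsGibbs.hasBoundedVariation {f : ℕ → SeqSpace k → ℝ} {μ : Measure (SeqSpace k)}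
    (h : IsGibbs f μ) : HasBoundedVariation shift f := by
  obtain ⟨-, P, -, K, hK, h⟩ := h
  have hK0 : 0 < K := by linarith
  have hlog : 0 ≤ Real.log K := Real.log_nonneg hK
  have key : ∀ (x y : SeqSpace k) (n : ℕ), 1 ≤ n → y ∈ PiNat.cylinder x n →
      f n x - f n y ≤ 2 * Real.log K := by
    intro x y n hn hxy
    have h1 := (le_div_iff₀ (Real.exp_pos _)).1 (h x n hn).1
    have h2 := (div_le_iff₀ (Real.exp_pos _)).1 (h y n hn).2
    rw [PiNat.mem_cylinder_iff_eq.1 hxy] at h2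
    have h3 := h1.trans h2
    rw [← Real.exp_log hK0, ← Real.exp_neg, ← Real.exp_add, ← Real.exp_add,
      Real.exp_le_exp] at h3
    linarith
  -- The summand `1` keeps the constant positive when `K = 1`; distance below `1` means equal first
  -- symbols.
  refine ⟨2 * Real.log K + 1, by linarith, 1, one_pos, fun x y n hn hxy => ?_⟩
  have hc := mem_cylinder_of_dist_shift_iterate_lt_one hxy
  have h1 := key x y n hn hc
  have h2 := key y x n hn ((PiNat.mem_cylinder_comm _ _ _).1 hc)
  rw [abs_le]
  constructor <;> linarith

end Cylinder

/-! ### Growth of the partition sums -/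

section PartitionSum

variable {k : ℕ} [NeZero k] {f : ℕ → SeqSpace k → ℝ} {C M : ℝ}

/-- The partition sum of `f n` over the words of length `n`. -/
noncomputable def wordSum (f : ℕ → SeqSpace k → ℝ) (n : ℕ) : ℝ :=
  ∑ w : Fin n → Fin k, Real.exp (f n (extendZero w))

theorem wordSum_pos (f : ℕ → SeqSpace k → ℝ) (n : ℕ) : 0 < wordSum f n :=
  Finset.sum_pos (fun _ _ => Real.exp_pos _) Finset.univ_nonempty

theorem abs_apply_extendZero_append_sub_le (hA : AlmostAdditiveWith f C)
    (hM : HasCylinderVariation f M) {m l : ℕ} (hm : 1 ≤ m) (hl : 1 ≤ l) (x : SeqSpace k)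
    (v : Fin l → Fin k) :
    |f (m + l) (extendZero (Fin.append (initialWord m x) v)) - (f m x + f l (extendZero v))| ≤
      C + M := by
  have h1 := abs_le.1 (hA (extendZero (Fin.append (initialWord m x) v)) m l hm hl)
  have h2 := abs_le.1 <| hM m x _ hm <|
    (extendZero_append_mem_cylinder_iff (initialWord m x) v x).2 rfl
  rw [shift_iterate_extendZero_append] at h1
  rw [abs_le]
  constructor <;> linarith [h1.1, h1.2, h2.1, h2.2]

theorem sum_exp_append_le (hA : AlmostAdditiveWith f C) (hM : HasCylinderVariation f M)
    {m l : ℕ} (hm : 1 ≤ m) (hl : 1 ≤ l) (x : SeqSpace k) :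
    ∑ v : Fin l → Fin k, Real.exp (f (m + l) (extendZero (Fin.append (initialWord m x) v))) ≤
      Real.exp (C + M + f m x) * wordSum f l := by
  rw [wordSum, Finset.mul_sum]
  refine Finset.sum_le_sum fun v _ => ?_
  rw [← Real.exp_add, Real.exp_le_exp]
  linarith [(abs_le.1 (abs_apply_extendZero_append_sub_le hA hM hm hl x v)).2]

theorem le_sum_exp_append (hA : AlmostAdditiveWith f C) (hM : HasCylinderVariation f M)
    {m l : ℕ} (hm : 1 ≤ m) (hl : 1 ≤ l) (x : SeqSpace k) :
    Real.exp (-(C + M) + f m x) * wordSum f l ≤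
      ∑ v : Fin l → Fin k, Real.exp (f (m + l) (extendZero (Fin.append (initialWord m x) v))) := by
  rw [wordSum, Finset.mul_sum]
  refine Finset.sum_le_sum fun v _ => ?_
  rw [← Real.exp_add, Real.exp_le_exp]
  linarith [(abs_le.1 (abs_apply_extendZero_append_sub_le hA hM hm hl x v)).1]

theorem wordSum_add (f : ℕ → SeqSpace k → ℝ) (m l : ℕ) :
    wordSum f (m + l) = ∑ u : Fin m → Fin k, ∑ v : Fin l → Fin k,
      Real.exp (f (m + l) (extendZero (Fin.append (initialWord m (extendZero u)) v))) := by
  rw [wordSum, ← (Fin.appendEquiv m l).sum_comp, Fintype.sum_prod_type]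
  simp only [initialWord_extendZero]
  rfl

theorem abs_log_wordSum_add_sub_le (hA : AlmostAdditiveWith f C) (hM : HasCylinderVariation f M)
    (m l : ℕ) (hm : 1 ≤ m) (hl : 1 ≤ l) :
    |Real.log (wordSum f (m + l)) - (Real.log (wordSum f m) + Real.log (wordSum f l))| ≤
      C + M := by
  have hpm := wordSum_pos f m
  have hpl := wordSum_pos f l
  have h1 : wordSum f (m + l) ≤ Real.exp (C + M) * (wordSum f m * wordSum f l) := by
    calc wordSum f (m + l)
        ≤ ∑ u : Fin m → Fin k, Real.exp (C + M + f m (extendZero u)) * wordSum f l := by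
          rw [wordSum_add]
          exact Finset.sum_le_sum fun u _ => sum_exp_append_le hA hM hm hl _
      _ = _ := by
          rw [wordSum.eq_def f m, Finset.sum_mul, Finset.mul_sum]
          simp only [Real.exp_add, mul_assoc]
  have h2 : Real.exp (-(C + M)) * (wordSum f m * wordSum f l) ≤ wordSum f (m + l) := by
    calc _ = ∑ u : Fin m → Fin k, Real.exp (-(C + M) + f m (extendZero u)) * wordSum f l := by
          rw [wordSum.eq_def f m, Finset.sum_mul, Finset.mul_sum]
          simp only [Real.exp_add, mul_assoc]
      _ ≤ wordSum f (m + l) := by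
          rw [wordSum_add]
          exact Finset.sum_le_sum fun u _ => le_sum_exp_append hA hM hm hl _
  have h3 := Real.log_le_log (wordSum_pos f _) h1
  have h4 := Real.log_le_log (by positivity) h2
  rw [Real.log_mul (Real.exp_ne_zero _) (by positivity), Real.log_exp,
    Real.log_mul hpm.ne' hpl.ne'] at h3 h4
  rw [abs_le]
  constructor <;> linarith

theorem exists_exp_le_wordSum_le (hA : AlmostAdditiveWith f C) (hM : HasCylinderVariation f M) :
    ∃ P : ℝ, ∀ n : ℕ, 1 ≤ n → Real.exp (n * P - (C + M)) ≤ wordSum f n ∧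
      wordSum f n ≤ Real.exp (n * P + (C + M)) := by
  obtain ⟨P, hP⟩ := exists_abs_sub_mul_le_of_almost_additive
    (u := fun n => Real.log (wordSum f n)) (abs_log_wordSum_add_sub_le hA hM)
  refine ⟨P, fun n hn => ?_⟩
  have h := abs_le.1 (hP n hn)
  rw [← Real.le_log_iff_exp_le (wordSum_pos f n), ← Real.log_le_iff_le_exp (wordSum_pos f n)]
  constructor <;> linarith [h.1, h.2]

end PartitionSum

/-! ### The growth rate is the pressure -/

section Pressure

theorem log_ofReal_exp_div_natCast (a P : ℝ) (n : ℕ) :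
    ENNReal.log (ENNReal.ofReal (Real.exp (n * P + a))) / (n : EReal) =
      (((n * P + a) / n : ℝ) : EReal) := by
  rw [ENNReal.log_ofReal_of_pos (Real.exp_pos _), Real.log_exp, EReal.coe_div]
  rfl

theorem tendsto_log_ofReal_exp_div_natCast (a P : ℝ) :
    Tendsto (fun n : ℕ => ENNReal.log (ENNReal.ofReal (Real.exp (n * P + a))) / (n : EReal))
      atTop (𝓝 (P : EReal)) := by
  simp only [log_ofReal_exp_div_natCast]
  refine (continuous_coe_real_ereal.tendsto P).comp ?_
  have h : Tendsto (fun n : ℕ => P + a / n) atTop (𝓝 P) := by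
    simpa using (tendsto_const_div_atTop_nhds_zero_nat a).const_add P
  refine h.congr' ?_
  filter_upwards [eventually_ge_atTop 1] with n hn
  have : (n : ℝ) ≠ 0 := by positivity
  field_simp

/-- One scale suffices for the lower bound because the pressure is a supremum over `ε`. -/
theorem pressure_eq_of_exp_bounds {X : Type*} [MetricSpace X] {T : X → X} {f : ℕ → X → ℝ} {P : ℝ}
    (hup : ∀ ε > 0, ∃ a : ℝ, ∀ n : ℕ, 1 ≤ n →
      separatedSum T f n ε ≤ ENNReal.ofReal (Real.exp (n * P + a)))
    (hlo : ∃ ε > 0, ∃ a : ℝ, ∀ n : ℕ, 1 ≤ n →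
      ENNReal.ofReal (Real.exp (n * P + a)) ≤ separatedSum T f n ε) :
    pressure T f = P := by
  apply le_antisymm
  · refine iSup₂_le fun ε hε => ?_
    obtain ⟨a, ha⟩ := hup ε hε
    rw [← (tendsto_log_ofReal_exp_div_natCast a P).limsup_eq]
    refine limsup_le_limsup ?_
    filter_upwards [eventually_ge_atTop 1] with n hn
    exact EReal.div_le_div_right_of_nonneg (Nat.cast_nonneg' n) (ENNReal.log_le_log (ha n hn))
  · obtain ⟨ε, hε, a, ha⟩ := hlo
    refine le_iSup₂_of_le ε hε ?_
    rw [← (tendsto_log_ofReal_exp_div_natCast a P).limsup_eq]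
    refine limsup_le_limsup ?_
    filter_upwards [eventually_ge_atTop 1] with n hn
    exact EReal.div_le_div_right_of_nonneg (Nat.cast_nonneg' n) (ENNReal.log_le_log (ha n hn))

variable {k : ℕ} [NeZero k] {f : ℕ → SeqSpace k → ℝ} {C M : ℝ}

theorem ofReal_wordSum_le_separatedSum (f : ℕ → SeqSpace k → ℝ) (n : ℕ) :
    ENNReal.ofReal (wordSum f n) ≤ separatedSum shift f n (1 / 2) := by
  have hinj : Function.Injective (extendZero : (Fin n → Fin k) → SeqSpace k) :=
    Function.LeftInverse.injective initialWord_extendZero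
  have hsep : IsDynSeparated shift n (1 / 2)
      (Finset.univ.map ⟨(extendZero : (Fin n → Fin k) → SeqSpace k), hinj⟩) := by
    simp only [IsDynSeparated, Finset.mem_map, Finset.mem_univ, true_and,
      Function.Embedding.coeFn_mk]
    rintro _ ⟨u, rfl⟩ _ ⟨v, rfl⟩ huv
    obtain ⟨i, hi⟩ := Function.ne_iff.1 (fun h => huv (congrArg extendZero h) : u ≠ v)
    refine ⟨i, i.2, ?_⟩
    rw [dist_eq_one_of_apply_zero_ne]
    · norm_num
    · simpa [shift_iterate_apply, extendZero] using hi
  refine le_iSup₂_of_le _ hsep ?_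
  rw [Finset.sum_map, wordSum, ENNReal.ofReal_sum_of_nonneg fun _ _ => (Real.exp_pos _).le]
  rfl

/-- Points agreeing on `n + q` symbols are not `(n, ε)`-separated, so a separated set injects into
words of length `n + q`. Replacing `f n` by `f (n + q)` at the extended word costs `B + C + M`. -/
theorem separatedSum_le_ofReal_wordSum (hA : AlmostAdditiveWith f C)
    (hM : HasCylinderVariation f M) {q : ℕ} {ε B : ℝ} (hq : 1 ≤ q) (hε : (1 / 2 : ℝ) ^ q ≤ ε)
    (hB : ∀ x, |f q x| ≤ B) (n : ℕ) (hn : 1 ≤ n) :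
    separatedSum shift f n ε ≤
      ENNReal.ofReal (Real.exp (B + C + M) * wordSum f (n + q)) := by
  refine iSup₂_le fun E hE => ?_
  have hinj : Set.InjOn (initialWord (n + q)) (E : Set (SeqSpace k)) := by
    intro x hx y hy hxy
    by_contra hne
    obtain ⟨j, hj, hlt⟩ := hE x hx y hy hne
    refine hlt.not_ge ((dist_shift_iterate_le hj fun i hi => ?_).trans hε)
    exact (congrFun hxy ⟨i, hi⟩).symm
  rw [← ENNReal.ofReal_sum_of_nonneg fun _ _ => (Real.exp_pos _).le]
  refine ENNReal.ofReal_le_ofReal ?_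
  calc ∑ x ∈ E, Real.exp (f n x)
      ≤ ∑ x ∈ E, Real.exp (B + C + M) *
          Real.exp (f (n + q) (extendZero (initialWord (n + q) x))) := by
        refine Finset.sum_le_sum fun x _ => ?_
        rw [← Real.exp_add, Real.exp_le_exp]
        have h1 := abs_le.1 (hA x n q hn hq)
        have h2 := abs_le.1 <| hM (n + q) x _ (by omega) <|
          (extendZero_mem_cylinder_iff (initialWord (n + q) x) x).2 rfl
        have h3 := abs_le.1 (hB (shift^[n] x))
        linarith [h1.1, h2.2, h3.1]
    _ = ∑ w ∈ E.image (initialWord (n + q)),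
          Real.exp (B + C + M) * Real.exp (f (n + q) (extendZero w)) :=
        (Finset.sum_image (f := fun w => Real.exp (B + C + M) *
          Real.exp (f (n + q) (extendZero w))) hinj).symm
    _ ≤ ∑ w, Real.exp (B + C + M) * Real.exp (f (n + q) (extendZero w)) :=
        Finset.sum_le_sum_of_subset_of_nonneg (Finset.subset_univ _) fun _ _ _ => by positivity
    _ = _ := by rw [wordSum, Finset.mul_sum]

theorem pressure_eq_of_exp_le_wordSum_le (hf : ∀ n, 1 ≤ n → Continuous (f n))
    (hA : AlmostAdditiveWith f C) (hM : HasCylinderVariation f M) {P D : ℝ}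
    (hP : ∀ n : ℕ, 1 ≤ n →
      Real.exp (n * P - D) ≤ wordSum f n ∧ wordSum f n ≤ Real.exp (n * P + D)) :
    pressure shift f = P := by
  refine pressure_eq_of_exp_bounds (fun ε hε => ?_) ⟨1 / 2, by norm_num, -D, fun n hn => ?_⟩
  · obtain ⟨q, hq⟩ := exists_pow_lt_of_lt_one hε (by norm_num : (1 / 2 : ℝ) < 1)
    obtain ⟨B, hB⟩ := exists_forall_abs_le_of_continuous (hf (q + 1) (by omega))
    refine ⟨B + C + M + (q + 1) * P + D, fun n hn => ?_⟩
    refine (separatedSum_le_ofReal_wordSum hA hM (by omega : 1 ≤ q + 1)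
      ((pow_le_pow_of_le_one (by norm_num) (by norm_num) q.le_succ).trans hq.le) hB n hn).trans ?_
    refine ENNReal.ofReal_le_ofReal ?_
    refine (mul_le_mul_of_nonneg_left (hP (n + (q + 1)) (by omega)).2
      (Real.exp_pos _).le).trans_eq ?_
    rw [← Real.exp_add]
    congr 1
    push_cast
    ring
  · refine le_trans (ENNReal.ofReal_le_ofReal ?_) (ofReal_wordSum_le_separatedSum f n)
    exact (hP n hn).1

end Pressure

/-! ### Construction of the Gibbs measure -/

section Gibbs

variable {k : ℕ}

theorem isClopen_cylinder (x : SeqSpace k) (n : ℕ) : IsClopen (PiNat.cylinder x n) := by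
  refine ⟨?_, PiNat.isOpen_cylinder _ x n⟩
  rw [PiNat.cylinder_eq_pi]
  exact isClosed_set_pi fun _ _ => isClosed_discrete _

variable [NeZero k] {f : ℕ → SeqSpace k → ℝ} {C M : ℝ}

/-- The probability measure on the zero-continued words of length `n` with weights proportional
to `exp (f n)`. -/
noncomputable def wordMeasure (f : ℕ → SeqSpace k → ℝ) (n : ℕ) : Measure (SeqSpace k) :=
  ∑ w : Fin n → Fin k,
    ENNReal.ofReal (Real.exp (f n (extendZero w)) / wordSum f n) • Measure.dirac (extendZero w)

open Classical in
theorem wordMeasure_apply (f : ℕ → SeqSpace k → ℝ) (n : ℕ) {s : Set (SeqSpace k)}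
    (hs : MeasurableSet s) :
    wordMeasure f n s = ENNReal.ofReal
      ((∑ w : Fin n → Fin k, if extendZero w ∈ s then Real.exp (f n (extendZero w)) else 0) /
        wordSum f n) := by
  have hp := wordSum_pos f n
  rw [wordMeasure, Measure.finsetSum_apply, Finset.sum_div, ENNReal.ofReal_sum_of_nonneg]
  · refine Finset.sum_congr rfl fun w _ => ?_
    rw [Measure.smul_apply, Measure.dirac_apply' _ hs]
    by_cases hw : extendZero w ∈ s <;> simp [hw]
  · intro w _
    split_ifs <;> positivity

instance (f : ℕ → SeqSpace k → ℝ) (n : ℕ) : IsProbabilityMeasure (wordMeasure f n) := by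
  constructor
  rw [wordMeasure_apply f n MeasurableSet.univ]
  simp only [Set.mem_univ, if_true]
  rw [← wordSum, div_self (wordSum_pos f n).ne', ENNReal.ofReal_one]

theorem wordMeasure_add_real_cylinder (f : ℕ → SeqSpace k → ℝ) (m l : ℕ) (x : SeqSpace k) :
    (wordMeasure f (m + l)).real (PiNat.cylinder x m) =
      (∑ v : Fin l → Fin k,
        Real.exp (f (m + l) (extendZero (Fin.append (initialWord m x) v)))) /
        wordSum f (m + l) := by
  classical
  have hp := wordSum_pos f (m + l)
  rw [Measure.real, wordMeasure_apply f _ (isClopen_cylinder x m).isOpen.measurableSet,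
    ENNReal.toReal_ofReal]
  · congr 1
    rw [← (Fin.appendEquiv m l).sum_comp, Fintype.sum_prod_type]
    rw [Finset.sum_eq_single (initialWord m x)]
    · refine Finset.sum_congr rfl fun v _ => ?_
      exact if_pos ((extendZero_append_mem_cylinder_iff _ v x).2 rfl)
    · intro u _ hu
      refine Finset.sum_eq_zero fun v _ => ?_
      exact if_neg (mt (extendZero_append_mem_cylinder_iff u v x).1 hu)
    · exact fun h => absurd (Finset.mem_univ _) h
  · refine div_nonneg (Finset.sum_nonneg fun w _ => ?_) hp.le
    split_ifs <;> positivity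

/-- The factor `3` collects one error `C + M` each from the sum over continuations, `wordSum f l`
and `wordSum f (m + l)`. -/
theorem wordMeasure_add_real_cylinder_bounds (hA : AlmostAdditiveWith f C)
    (hM : HasCylinderVariation f M) {P : ℝ}
    (hP : ∀ n : ℕ, 1 ≤ n → Real.exp (n * P - (C + M)) ≤ wordSum f n ∧
      wordSum f n ≤ Real.exp (n * P + (C + M)))
    {m l : ℕ} (hm : 1 ≤ m) (hl : 1 ≤ l) (x : SeqSpace k) :
    Real.exp (-(3 * (C + M)) + (-(m * P) + f m x)) ≤
        (wordMeasure f (m + l)).real (PiNat.cylinder x m) ∧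
      (wordMeasure f (m + l)).real (PiNat.cylinder x m) ≤
        Real.exp (3 * (C + M) + (-(m * P) + f m x)) := by
  have hp := wordSum_pos f (m + l)
  obtain ⟨h1, h2⟩ := hP l hl
  obtain ⟨h3, h4⟩ := hP (m + l) (by omega)
  rw [wordMeasure_add_real_cylinder, le_div_iff₀ hp, div_le_iff₀ hp]
  constructor
  · refine le_trans ?_ (le_sum_exp_append hA hM hm hl x)
    refine (mul_le_mul_of_nonneg_left h4 (Real.exp_pos _).le).trans
      (le_trans ?_ (mul_le_mul_of_nonneg_left h1 (Real.exp_pos _).le))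
    rw [← Real.exp_add, ← Real.exp_add, Real.exp_le_exp]
    push_cast
    linarith
  · refine (sum_exp_append_le hA hM hm hl x).trans ?_
    refine (mul_le_mul_of_nonneg_left h2 (Real.exp_pos _).le).trans
      (le_trans ?_ (mul_le_mul_of_nonneg_left h3 (Real.exp_pos _).le))
    rw [← Real.exp_add, ← Real.exp_add, Real.exp_le_exp]
    push_cast
    linarith

theorem exists_isGibbs (hf : ∀ n, 1 ≤ n → Continuous (f n)) (hA : AlmostAdditiveWith f C)
    (hM : HasCylinderVariation f M) : ∃ μ : Measure (SeqSpace k), IsGibbs f μ := by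
  obtain ⟨P, hP⟩ := exists_exp_le_wordSum_le hA hM
  have hD : 0 ≤ C + M := (abs_nonneg _).trans
    (abs_log_wordSum_add_sub_le hA hM 1 1 le_rfl le_rfl)
  let ν : ℕ → ProbabilityMeasure (SeqSpace k) := fun n => ⟨wordMeasure f n, inferInstance⟩
  -- Probability measures on a compact metrizable space form a compact space, so a limit along an
  -- ultrafilter exists.
  obtain ⟨μ, -, hμ⟩ := isCompact_univ.ultrafilter_le_nhds ((hyperfilter ℕ).map ν) (by simp)
  have hlim : Tendsto ν (hyperfilter ℕ) (𝓝 μ) := hμ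
  refine ⟨μ, inferInstance, P, pressure_eq_of_exp_le_wordSum_le hf hA hM hP,
    Real.exp (3 * (C + M)), Real.one_le_exp (by positivity), fun x n hn => ?_⟩
  have ht : Tendsto (fun i => (wordMeasure f i).real (PiNat.cylinder x n)) (hyperfilter ℕ)
      (𝓝 ((μ : Measure (SeqSpace k)).real (PiNat.cylinder x n))) :=
    (ENNReal.tendsto_toReal (measure_ne_top _ _)).comp <|
      ProbabilityMeasure.tendsto_measure_of_null_frontier_of_tendsto' hlim
        (by simp [(isClopen_cylinder x n).frontier_eq])
  -- Strictly more than `n` symbols, so that the continuation length `l` is at least `1`.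
  have hev : ∀ᶠ i in (hyperfilter ℕ : Filter ℕ), n + 1 ≤ i :=
    Nat.hyperfilter_le_atTop (eventually_ge_atTop (n + 1))
  have hb : ∀ᶠ i in (hyperfilter ℕ : Filter ℕ),
      Real.exp (-(3 * (C + M)) + (-(n * P) + f n x)) ≤
          (wordMeasure f i).real (PiNat.cylinder x n) ∧
        (wordMeasure f i).real (PiNat.cylinder x n) ≤
          Real.exp (3 * (C + M) + (-(n * P) + f n x)) := by
    filter_upwards [hev] with i hi
    obtain ⟨l, rfl⟩ := Nat.exists_eq_add_of_le (by omega : n ≤ i)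
    exact wordMeasure_add_real_cylinder_bounds hA hM hP hn (by omega) x
  rw [le_div_iff₀ (Real.exp_pos _), div_le_iff₀ (Real.exp_pos _), ← Real.exp_neg,
    ← Real.exp_add, ← Real.exp_add]
  exact ⟨ge_of_tendsto ht (hb.mono fun _ h => h.1), le_of_tendsto ht (hb.mono fun _ h => h.2)⟩

theorem hasBoundedVariation_iff_exists_isGibbs (hf : ∀ n, 1 ≤ n → Continuous (f n))
    (hA : AlmostAdditive shift f) :
    HasBoundedVariation shift f ↔ ∃ μ : Measure (SeqSpace k), IsGibbs f μ := by
  obtain ⟨C, hC⟩ := hA.exists_with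
  refine ⟨fun h => ?_, fun ⟨μ, hμ⟩ => hμ.hasBoundedVariation⟩
  obtain ⟨M, hM⟩ := h.exists_hasCylinderVariation hf hC
  exact exists_isGibbs hf hC hM

end Gibbs

/-! ### Birkhoff sums and the conclusion -/

theorem almostAdditive_birkhoffSum {X : Type*} [MetricSpace X] (T : X → X) (φ : X → ℝ) :
    AlmostAdditive T (birkhoffSum T φ) :=
  ⟨1, one_pos, fun x m n _ _ => by
    rw [birkhoffSum_add]
    constructor <;> linarith⟩

theorem continuous_birkhoffSum {X : Type*} [TopologicalSpace X] {T : X → X} {φ : X → ℝ}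
    (hT : Continuous T) (hφ : Continuous φ) (n : ℕ) : Continuous (birkhoffSum T φ n) :=
  continuous_finsetSum _ fun j _ => hφ.comp (hT.iterate j)

end NonaddThermo

theorem proposition4p8 (k : ℕ) (hk : 1 ≤ k) :
    (∀ φ : NonaddThermo.SeqSpace k → ℝ, Continuous φ →
      (NonaddThermo.IsBowen NonaddThermo.shift φ ↔
        ∃ μ : MeasureTheory.Measure (NonaddThermo.SeqSpace k), NonaddThermo.IsGibbsFor φ μ)) ∧
    (∀ f : ℕ → NonaddThermo.SeqSpace k → ℝ, (∀ n, 1 ≤ n → Continuous (f n)) →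
      NonaddThermo.AlmostAdditive NonaddThermo.shift f →
      (NonaddThermo.HasBoundedVariation NonaddThermo.shift f ↔
        ∃ μ : MeasureTheory.Measure (NonaddThermo.SeqSpace k), NonaddThermo.IsGibbs f μ)) := by

  have : NeZero k := ⟨by omega⟩
  refine ⟨fun φ hφ => ?_, fun f hf hA => ?_⟩
  · exact NonaddThermo.hasBoundedVariation_iff_exists_isGibbs
      (fun n _ => NonaddThermo.continuous_birkhoffSum NonaddThermo.continuous_shift hφ n)
      (NonaddThermo.almostAdditive_birkhoffSum _ φ)
  · exact NonaddThermo.hasBoundedVariation_iff_exists_isGibbs hf hA
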